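/- Let $n,k$ be integers with $0\le k\le n$. For $w\in S_n$ let $F_k(w)$ be the number of $k$-element subsets $S\subseteq\{1,\dots,n\}$ with $w(S)=S$. The top-$k$-to-random shuffle of a deck of $n$ cards is the Markov chain on the $n!$ arrangements of the deck (identified with $S_n$) in which each step removes the top $k$ cards and interleaves them with the other $n-k$ cards, keeping the relative order within each of the two groups, all $\binom nk$ interleavings being equally likely and the steps being independent. 1. The eigenvalues of the $n!\times n!$ transition matrix of this shuffle are the numbers $F_k(w)/\binom nk$, where $w$ ranges over $S_n$, counted with algebraic multiplicity: the multiset of the $n!$ complex roots of the characteristic polynomial is $\{F_k(w)/\binom nk : w\in S_n\}$. 2. For every integer $r\ge 0$, $$\frac1{n!}\sum_{w\in S_n}F_k(w)^r=\binom nk^{r}\cdot P_r,$$ where $P_r$ is the probability that the shuffle, started at the identity arrangement, is at the identity arrangement after $r$ steps (with the convention $0^0=1$). -/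

import Mathlib

namespace TopToRandom

open Equiv

/-- The number `F_k(w)` of fixed points of `w ∈ S_n` acting on the `k`-subsets of an `n`-set. -/
def fixedSets (n k : ℕ) (w : Perm (Fin n)) : ℕ :=
  ((Finset.univ.powersetCard k).filter fun S : Finset (Fin n) => S.image w = S).card

/-- The `r`-th moment of `F_k(w)` for `w` uniformly distributed on `S_n`. -/
noncomputable def fixedSetsMoment (n k r : ℕ) : ℝ :=
  (∑ w : Perm (Fin n), (fixedSets n k w : ℝ) ^ r) / (Fintype.card (Perm (Fin n)) : ℝ)

/-- The `k`-subsets of the `n` positions of a deck. Choosing where the `k` removed cards end up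
is the same as choosing an interleaving. -/
abbrev Interleaving (n k : ℕ) : Type :=
  {S : Finset (Fin n) // S.card = k}

theorem Interleaving.nonempty {n k : ℕ} (hk : k ≤ n) : Nonempty (Interleaving n k) := by
  obtain ⟨S, -, hS⟩ := Finset.exists_subset_card_eq (s := (Finset.univ : Finset (Fin n)))
    (n := k) (by simpa using hk)
  exact ⟨⟨S, hS⟩⟩

/-- Where the card in each position goes (position `0` is the top): the positions `0, …, k - 1`
are sent increasingly onto `S`, the positions `k, …, n - 1` increasingly onto the complement
of `S`. -/
def interleave {n k : ℕ} (hk : k ≤ n) (S : Interleaving n k) : Perm (Fin n) :=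
  (finCongr (Nat.add_sub_of_le hk).symm).trans <|
    finSumFinEquiv.symm.trans <|
      finSumEquivOfFinset S.2 (by rw [Finset.card_compl, Fintype.card_fin, S.2])

/-- One step of the top `k` to random shuffle of `n` cards. A deck `d` is a permutation, `d i`
being the card in position `i`; after the interleaving `S` the card that was in position `i` is
in position `interleave hk S i`. The interleaving is uniformly distributed. -/
noncomputable def step {n k : ℕ} (hk : k ≤ n) (d : Perm (Fin n)) : PMF (Perm (Fin n)) :=
  haveI := Interleaving.nonempty hk
  (PMF.uniformOfFintype (Interleaving n k)).map fun S => d * (interleave hk S)⁻¹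

/-- The transition matrix of the top `k` to random shuffle. -/
noncomputable def transition {n k : ℕ} (hk : k ≤ n) : Matrix (Perm (Fin n)) (Perm (Fin n)) ℝ :=
  Matrix.of fun d e => (step hk d e).toReal

/-- The law of the deck after `r` independent shuffles, started from the identity. -/
noncomputable def law {n k : ℕ} (hk : k ≤ n) : ℕ → PMF (Perm (Fin n))
  | 0 => PMF.pure 1
  | r + 1 => (law hk r).bind (step hk)

end TopToRandom

/-! ### Power sums of the eigenvalues of a matrix -/

section

open Polynomial

/-! In characteristic zero a multiset is determined by its power sums, and those of the eigenvalues
are the traces of matrix powers. So both claims reduce to `sum_fixedSets_pow_eq_trace`, proved by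
counting `r`-tuples `T` of `k`-subsets. Each card gets a word, its non-membership bits in `T`.
Undoing shuffles is radix sort, so returns to `1` in `r` steps correspond to tuples whose words are
already sorted (`transition_pow_apply_one`). On the other side, `F_k(w)^r` counts tuples whose words
`w` preserves. The permutations sorting the words of `T` form a coset of their stabilizer, so
summing over `w` gives `n!` times the same count (`sum_fixedSets_pow`). -/

/-- Both sides are multiplicative in `p`, which splits; a linear factor is a value of the
characteristic polynomial up to sign. -/
theorem Matrix.det_aeval_eq_prod_roots {ι K : Type*} [Fintype ι] [DecidableEq ι] [Field K]
    [IsAlgClosed K] (A : Matrix ι ι K) (p : K[X]) :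
    (aeval A p).det = (A.charpoly.roots.map fun x => p.eval x).prod := by
  have hcard : A.charpoly.roots.card = Fintype.card ι := by
    rw [← (IsAlgClosed.splits A.charpoly).natDegree_eq_card_roots, A.charpoly_natDegree_eq_dim]
  have hlin (c : K) : (aeval A (X - C c)).det =
      (A.charpoly.roots.map fun x => (X - C c).eval x).prod := by
    have h1 : A.charpoly = (A.charpoly.roots.map fun x => X - C x).prod :=
      ((IsAlgClosed.splits A.charpoly).eq_prod_roots_of_monic A.charpoly_monic)
    have h2 : A.charpoly.eval c = (A.charpoly.roots.map fun x => c - x).prod := by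
      conv_lhs => rw [h1]
      simp [eval_multiset_prod]
    have h3 : aeval A (X - C c) = -(Matrix.scalar ι c - A) := by
      simp [Matrix.algebraMap_eq_diagonal, Pi.algebraMap_def]
    rw [h3, Matrix.det_neg, ← Matrix.eval_charpoly, h2, ← hcard]
    rw [← Multiset.card_map (fun x => c - x), ← Multiset.prod_map_neg, Multiset.map_map]
    simp
  have hp := (IsAlgClosed.splits p).eq_prod_roots
  have hmul : ∀ s : Multiset K, (aeval A (s.map fun c => X - C c).prod).det =
      (A.charpoly.roots.map fun x => ((s.map fun c => X - C c).prod).eval x).prod := by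
    intro s
    induction s using Multiset.induction_on with
    | empty => simp
    | cons a s ih =>
      simp only [Multiset.map_cons, Multiset.prod_cons, map_mul, Matrix.det_mul, eval_mul,
        Multiset.prod_map_mul]
      rw [ih, hlin]
  rw [hp]
  simp only [map_mul, Matrix.det_mul, hmul, eval_mul, Multiset.prod_map_mul, aeval_C, eval_C,
    Multiset.map_const', Multiset.prod_replicate, hcard]
  simp [Matrix.algebraMap_eq_diagonal]

theorem Matrix.roots_charpoly_pow {ι K : Type*} [Fintype ι] [DecidableEq ι] [Field K]
    [IsAlgClosed K] (A : Matrix ι ι K) (r : ℕ) :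
    (A ^ r).charpoly.roots = A.charpoly.roots.map (· ^ r) := by
  have : (A ^ r).charpoly = ((A.charpoly.roots.map (· ^ r)).map fun x => X - C x).prod := by
    have : Infinite K := IsAlgClosed.instInfinite
    refine Polynomial.funext fun c => ?_
    have h := A.det_aeval_eq_prod_roots (C c - X ^ r)
    rw [Matrix.eval_charpoly, eval_multiset_prod]
    simpa [Matrix.algebraMap_eq_diagonal, Pi.algebraMap_def, Function.comp_def] using h
  rw [this, roots_multiset_prod_X_sub_C]

theorem Matrix.trace_pow_eq_sum_roots_charpoly {ι K : Type*} [Fintype ι] [DecidableEq ι] [Field K]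
    [IsAlgClosed K] (A : Matrix ι ι K) (r : ℕ) :
    (A ^ r).trace = (A.charpoly.roots.map (· ^ r)).sum := by
  rw [Matrix.trace_eq_sum_roots_charpoly, Matrix.roots_charpoly_pow]

/-- By linearity the sums of any polynomial agree; one vanishing at every element except `a`
isolates the multiplicity of `a`. -/
theorem Multiset.eq_of_sum_map_pow_eq {K : Type*} [Field K] [CharZero K] {s t : Multiset K}
    (h : ∀ r : ℕ, (s.map (· ^ r)).sum = (t.map (· ^ r)).sum) : s = t := by
  classical
  have hp (p : K[X]) : (s.map fun x => p.eval x).sum = (t.map fun x => p.eval x).sum := by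
    induction p using Polynomial.induction_on' with
    | add p q hp hq => simp only [eval_add, Multiset.sum_map_add, hp, hq]
    | monomial r c => simp only [eval_monomial, Multiset.sum_map_mul_left, h r]
  ext a
  let u := (s + t).toFinset.erase a
  let p : K[X] := ∏ b ∈ u, (X - C b)
  have hpa : p.eval a ≠ 0 := by
    simp only [p, eval_prod, eval_sub, eval_X, eval_C]
    exact Finset.prod_ne_zero_iff.2 fun b hb => sub_ne_zero.2 (Finset.ne_of_mem_erase hb).symm
  have key (m : Multiset K) (hm : m ≤ s + t) :
      (m.map fun x => p.eval x).sum = m.count a * p.eval a := by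
    rw [Finset.sum_multiset_map_count, Finset.sum_eq_single a, nsmul_eq_mul]
    · intro x hx hxa
      simp only [p, eval_prod]
      rw [Finset.prod_eq_zero (i := x) _ (by simp), smul_zero]
      exact Finset.mem_erase.2
        ⟨hxa, Multiset.mem_toFinset.2 (Multiset.mem_of_le hm (Multiset.mem_toFinset.1 hx))⟩
    · intro ha
      rw [Multiset.count_eq_zero.2 (fun h => ha (Multiset.mem_toFinset.2 h)), zero_smul]
  have := hp p
  rw [key s (Multiset.le_add_right _ _), key t (Multiset.le_add_left _ _)] at this
  exact_mod_cast mul_right_cancel₀ hpa this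

end

/-! ### Shuffles as stable sorts -/

/-- `Tuple.sort` is stable: sorting by the minor key `f`, then by the major key `g`, is a
lexicographic sort. -/
theorem Tuple.sort_mul_sort_comp {n : ℕ} {α β γ : Type*} [LinearOrder α] [LinearOrder β]
    [LinearOrder γ] {f : Fin n → α} {g : Fin n → β} {h : Fin n → γ}
    (hh : ∀ i j, h i < h j ↔ g i < g j ∨ g i = g j ∧ f i < f j) :
    Tuple.sort f * Tuple.sort (g ∘ Tuple.sort f) = Tuple.sort h := by
  set σ := Tuple.sort f with hσ
  set τ := Tuple.sort (g ∘ σ) with hτ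
  obtain ⟨hσ1, hσ2⟩ := Tuple.eq_sort_iff.1 hσ
  obtain ⟨hτ1, hτ2⟩ := Tuple.eq_sort_iff.1 hτ
  have hle (i j) (hij : i < j) (e : g (σ (τ i)) = g (σ (τ j))) : f (σ (τ i)) ≤ f (σ (τ j)) :=
    hσ1 (hτ2 i j hij e).le
  rw [Tuple.eq_sort_iff]
  constructor
  · intro i j hij
    rcases hij.eq_or_lt with rfl | hij
    · rfl
    refine not_lt.1 fun hlt => ?_
    have hg : g (σ (τ i)) ≤ g (σ (τ j)) := hτ1 hij.le
    rcases (hh _ _).1 hlt with h1 | ⟨h1, h2⟩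
    · exact absurd h1 hg.not_gt
    · exact absurd h2 (hle i j hij h1.symm).not_gt
  · intro i j hij e
    have hg : g (σ (τ i)) ≤ g (σ (τ j)) := hτ1 hij.le
    have h1 := (hh (σ (τ i)) (σ (τ j))).not.1 (by simpa using e.not_lt)
    have h2 := (hh (σ (τ j)) (σ (τ i))).not.1 (by simpa using e.not_gt)
    push Not at h1 h2
    have eg : g (σ (τ i)) = g (σ (τ j)) := le_antisymm hg h1.1
    have ef : f (σ (τ i)) = f (σ (τ j)) := le_antisymm (h2.2 eg.symm) (h1.2 eg)
    exact hσ2 _ _ (hτ2 i j hij eg) ef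

namespace TopToRandom
open Equiv

variable {n k : ℕ}

theorem interleave_castAdd (hk : k ≤ n) (S : Interleaving n k) (i : Fin k) :
    interleave hk S (Fin.cast (Nat.add_sub_of_le hk) (Fin.castAdd (n - k) i)) =
      S.1.orderEmbOfFin S.2 i := by
  simp [interleave, finCongr]

theorem interleave_natAdd (hk : k ≤ n) (S : Interleaving n k) (i : Fin (n - k)) :
    interleave hk S (Fin.cast (Nat.add_sub_of_le hk) (Fin.natAdd k i)) =
      S.1ᶜ.orderEmbOfFin (by rw [Finset.card_compl, Fintype.card_fin, S.2]) i := by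
  simp [interleave, finCongr]

theorem interleave_eq_sort (hk : k ≤ n) (S : Interleaving n k) :
    interleave hk S = Tuple.sort fun i => decide (i ∉ S.1) := by
  have hmem (i : Fin k) := S.1.orderEmbOfFin_mem S.2 i
  have hmem' (i : Fin (n - k)) := Finset.mem_compl.1 (S.1ᶜ.orderEmbOfFin_mem
    (by rw [Finset.card_compl, Fintype.card_fin, S.2]) i)
  have hsurj (i : Fin n) : (∃ j, i = Fin.cast (Nat.add_sub_of_le hk) (Fin.castAdd (n - k) j)) ∨
      ∃ j, i = Fin.cast (Nat.add_sub_of_le hk) (Fin.natAdd k j) := by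
    obtain ⟨i, rfl⟩ := (finCongr (Nat.add_sub_of_le hk)).surjective i
    refine Fin.addCases (fun j => .inl ⟨j, rfl⟩) (fun j => .inr ⟨j, rfl⟩) i
  rw [Tuple.eq_sort_iff]
  constructor
  · intro i j hij
    rcases hsurj i with ⟨a, rfl⟩ | ⟨a, rfl⟩ <;> rcases hsurj j with ⟨b, rfl⟩ | ⟨b, rfl⟩ <;>
      simp only [Function.comp, interleave_castAdd, interleave_natAdd, hmem, hmem', not_true,
        not_false_iff, decide_true, decide_false, le_refl, Bool.false_le]
    -- Left over is `i` among the last `n - k` positions and `j` among the first `k`, impossible as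
    -- `i ≤ j`.
    have : k + a.1 ≤ b.1 := hij
    omega
  · intro i j hij
    rcases hsurj i with ⟨a, rfl⟩ | ⟨a, rfl⟩ <;> rcases hsurj j with ⟨b, rfl⟩ | ⟨b, rfl⟩ <;>
      simp only [interleave_castAdd, interleave_natAdd, hmem, hmem', not_true,
        not_false_iff, decide_true, decide_false, reduceCtorEq, false_imp_iff, true_imp_iff,
        OrderEmbedding.lt_iff_lt]
    · exact hij
    · have : k + a.1 < k + b.1 := hij
      exact Fin.lt_def.2 (by omega)

/-- The membership word of a card in a family of `k`-subsets, compared lexicographically. -/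
def key {r : ℕ} (T : Fin r → Interleaving n k) (i : Fin n) : Lex (Fin r → Bool) :=
  toLex fun j => decide (i ∉ (T j).1)

theorem key_cons_lt_iff {r : ℕ} (S : Interleaving n k) (T : Fin r → Interleaving n k)
    (i j : Fin n) :
    key (Fin.cons S T : Fin (r + 1) → Interleaving n k) i <
        key (Fin.cons S T : Fin (r + 1) → Interleaving n k) j ↔
      decide (i ∉ S.1) < decide (j ∉ S.1) ∨
        decide (i ∉ S.1) = decide (j ∉ S.1) ∧ key T i < key T j := by
  have hc (i : Fin n) :
      ofLex (key (Fin.cons S T : Fin (r + 1) → Interleaving n k) i) =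
        Fin.cons (α := fun _ => Bool) (decide (i ∉ S.1)) (ofLex (key T i)) := by
    funext l
    refine Fin.cases ?_ (fun l => ?_) l <;> simp [key]
  change Pi.Lex (· < ·) (· < ·)
    (ofLex (key (Fin.cons S T : Fin (r + 1) → Interleaving n k) i))
    (ofLex (key (Fin.cons S T : Fin (r + 1) → Interleaving n k) j)) ↔ _
  rw [hc, hc, Fin.pi_lex_lt_cons_cons]
  rfl

/-- Permutations act on the `k`-subsets by taking preimages. -/
def Interleaving.preimage (u : Perm (Fin n)) : Interleaving n k ≃ Interleaving n k where
  toFun S := ⟨S.1.map u.symm.toEmbedding, by simp [S.2]⟩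
  invFun S := ⟨S.1.map u.toEmbedding, by simp [S.2]⟩
  left_inv S := by ext; simp
  right_inv S := by ext; simp

theorem Interleaving.mem_preimage (u : Perm (Fin n)) (S : Interleaving n k) (i : Fin n) :
    i ∈ (Interleaving.preimage u S).1 ↔ u i ∈ S.1 := by
  simp [Interleaving.preimage, Finset.mem_map_equiv]

/-- One more radix pass, with `S` as the most significant digit; the preimage expresses `S` in the
positions reached by the earlier passes. -/
theorem sort_key_cons (hk : k ≤ n) {r : ℕ} (S : Interleaving n k) (T : Fin r → Interleaving n k) :
    Tuple.sort (key (Fin.cons S T : Fin (r + 1) → Interleaving n k)) =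
      Tuple.sort (key T) * interleave hk (Interleaving.preimage (Tuple.sort (key T)) S) := by
  rw [← Tuple.sort_mul_sort_comp (key_cons_lt_iff S T), interleave_eq_sort]
  simp only [Interleaving.mem_preimage]
  rfl

/-! ### Return probabilities -/

theorem card_interleaving : Fintype.card (Interleaving n k) = n.choose k := by
  rw [Fintype.card_finset_len, Fintype.card_fin]

theorem transition_apply (hk : k ≤ n) (d e : Perm (Fin n)) :
    transition hk d e =
      (n.choose k : ℝ)⁻¹ * ∑ S : Interleaving n k, if d * (interleave hk S)⁻¹ = e then 1 else 0 := by
  classical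
  simp only [transition, step, Matrix.of_apply, PMF.map_apply, PMF.uniformOfFintype_apply,
    tsum_fintype, card_interleaving]
  rw [ENNReal.toReal_sum (fun S _ => by
    split_ifs <;> simp [(Nat.choose_pos hk).ne']), Finset.mul_sum]
  refine Finset.sum_congr rfl fun S _ => ?_
  rw [eq_comm]
  split_ifs <;> simp_all

theorem law_apply_toReal (hk : k ≤ n) (r : ℕ) (e : Perm (Fin n)) :
    (law hk r e).toReal = (transition hk ^ r) 1 e := by
  classical
  induction r generalizing e with
  | zero =>
    simp only [law, PMF.pure_apply, pow_zero, Matrix.one_apply, eq_comm]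
    split_ifs <;> simp
  | succ r ih =>
    rw [law, PMF.bind_apply, tsum_fintype, ENNReal.toReal_sum
      (fun d _ => ENNReal.mul_ne_top (PMF.apply_ne_top _ _) (PMF.apply_ne_top _ _)),
      pow_succ, Matrix.mul_apply]
    refine Finset.sum_congr rfl fun d _ => ?_
    rw [ENNReal.toReal_mul, ih]
    rfl

/-- Left multiplication only renames the cards, so all diagonal entries of a power will agree. -/
theorem transition_mul_left (hk : k ≤ n) (g d e : Perm (Fin n)) :
    transition hk (g * d) (g * e) = transition hk d e := by
  simp only [transition_apply, mul_assoc, mul_right_inj]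

theorem transition_pow_mul_left (hk : k ≤ n) (r : ℕ) (g d e : Perm (Fin n)) :
    (transition hk ^ r) (g * d) (g * e) = (transition hk ^ r) d e := by
  induction r generalizing d e with
  | zero => simp [Matrix.one_apply]
  | succ r ih =>
    rw [pow_succ, Matrix.mul_apply, Matrix.mul_apply]
    refine Fintype.sum_equiv (Equiv.mulLeft g⁻¹) _ _ fun x => ?_
    rw [← ih d, ← transition_mul_left hk g _ e]
    simp

theorem trace_transition_pow (hk : k ≤ n) (r : ℕ) :
    (transition hk ^ r).trace = Fintype.card (Perm (Fin n)) * (transition hk ^ r) 1 1 := by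
  have h (g : Perm (Fin n)) : (transition hk ^ r) g g = (transition hk ^ r) 1 1 := by
    simpa using transition_pow_mul_left hk r g 1 1
  simp [Matrix.trace, h]

/-- Undoing the shuffles is a radix sort, so the return probabilities count the families of
`k`-subsets whose membership words are sorted by a given permutation. -/
theorem transition_pow_apply_one (hk : k ≤ n) (r : ℕ) (d : Perm (Fin n)) :
    (n.choose k : ℝ) ^ r * (transition hk ^ r) d 1 =
      ∑ T : Fin r → Interleaving n k, if Tuple.sort (key T) = d then 1 else 0 := by
  have hC : (n.choose k : ℝ) ≠ 0 := by exact_mod_cast (Nat.choose_pos hk).ne'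
  induction r generalizing d with
  | zero =>
    have h : Tuple.sort (key (default : Fin 0 → Interleaving n k)) = 1 :=
      Tuple.sort_eq_refl_iff_monotone.2 fun i j _ => le_of_eq (Subsingleton.elim _ _)
    rw [Fintype.sum_unique, h]
    simp [Matrix.one_apply, eq_comm]
  | succ r ih =>
    have hr : (n.choose k : ℝ) ^ (r + 1) * (transition hk ^ (r + 1)) d 1 =
        ∑ S : Interleaving n k, (n.choose k : ℝ) ^ r *
          (transition hk ^ r) (d * (interleave hk S)⁻¹) 1 := by
      -- Condition on the first of the `r + 1` shuffles.
      rw [pow_succ' (transition hk), Matrix.mul_apply, pow_succ', mul_assoc, Finset.mul_sum,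
        Finset.mul_sum]
      simp only [transition_apply, Finset.mul_sum, Finset.sum_mul]
      rw [Finset.sum_comm]
      refine Finset.sum_congr rfl fun S _ => ?_
      rw [Finset.sum_eq_single (d * (interleave hk S)⁻¹)]
      · simp; field_simp
      · intro b _ hb
        simp [hb.symm]
      · simp
    rw [hr]
    simp only [ih]
    rw [Finset.sum_comm, ← (Fin.consEquiv fun _ => Interleaving n k).sum_comp,
      Fintype.sum_prod_type_right]
    refine Finset.sum_congr rfl fun T _ => ?_
    -- For fixed `T`, reindexing `S` by this bijection matches `sort_key_cons`.
    rw [← (Interleaving.preimage (Tuple.sort (key T))).sum_comp]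
    refine Finset.sum_congr rfl fun S _ => ?_
    refine if_congr ?_ rfl rfl
    rw [eq_mul_inv_iff_mul_eq, ← sort_key_cons hk]
    rfl

/-! ### Moments of the fixed-set count -/

theorem key_preimage {r : ℕ} (u : Perm (Fin n)) (T : Fin r → Interleaving n k) :
    key (fun j => Interleaving.preimage u (T j)) = key T ∘ u := by
  funext i
  simp [key, Interleaving.mem_preimage]

theorem key_comp_eq_iff {r : ℕ} (w : Perm (Fin n)) (T : Fin r → Interleaving n k) :
    key T ∘ w = key T ↔ ∀ j, (T j).1.image w = (T j).1 := by
  have h (S : Finset (Fin n)) : S.image w = S ↔ ∀ i, w i ∈ S ↔ i ∈ S := by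
    constructor
    · intro hS i
      conv_lhs => rw [← hS]
      simp
    · intro hS
      ext i
      rw [Finset.mem_image]
      exact ⟨fun ⟨a, ha, e⟩ => e ▸ (hS a).2 ha, fun hi => ⟨w.symm i,
        (hS _).1 (by simpa using hi), w.apply_symm_apply i⟩⟩
  simp only [h, funext_iff, Function.comp, key, toLex_inj, decide_eq_decide, not_iff_not]
  exact forall_comm

theorem fixedSets_eq_card (w : Perm (Fin n)) :
    fixedSets n k w = Fintype.card {S : Interleaving n k // S.1.image w = S.1} := by
  classical
  rw [fixedSets, ← Fintype.card_coe]
  refine Fintype.card_congr ((Equiv.subtypeEquivRight fun S => ?_).trans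
    (Equiv.subtypeSubtypeEquivSubtypeInter (fun S : Finset (Fin n) => S.card = k)
      fun S => S.image w = S).symm)
  simp [Finset.mem_powersetCard]

theorem fixedSets_pow (r : ℕ) (w : Perm (Fin n)) :
    fixedSets n k w ^ r =
      ∑ T : Fin r → Interleaving n k, if key T ∘ w = key T then 1 else 0 := by
  classical
  rw [fixedSets_eq_card, ← Finset.card_filter, ← Fintype.card_subtype]
  have := Fintype.card_fun (α := Fin r) (β := {S : Interleaving n k // S.1.image w = S.1})
  rw [Fintype.card_fin] at this
  rw [← this]
  refine Fintype.card_congr ((Equiv.subtypePiEquivPi).symm.trans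
    (Equiv.subtypeEquivRight fun T => (key_comp_eq_iff w T).symm))

/-- The permutations sorting `f` form a coset of the stabilizer of `f`. -/
theorem sum_comp_eq_self_eq_sum_monotone {α : Type*} [LinearOrder α] (f : Fin n → α) :
    (∑ w : Perm (Fin n), if f ∘ w = f then 1 else 0 : ℕ) =
      ∑ u : Perm (Fin n), if Tuple.sort (f ∘ u) = 1 then 1 else 0 := by
  rw [← Equiv.sum_comp (Equiv.mulRight (Tuple.sort f))
    (fun u : Perm (Fin n) => (if Tuple.sort (f ∘ u) = 1 then 1 else 0 : ℕ))]
  refine Finset.sum_congr rfl fun w _ => if_congr ?_ rfl rfl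
  change _ ↔ Tuple.sort (f ∘ (w * Tuple.sort f : Perm (Fin n))) = Equiv.refl _
  rw [Tuple.sort_eq_refl_iff_monotone, ← Tuple.comp_sort_eq_comp_iff_monotone, Perm.coe_mul,
    ← Function.comp_assoc, (Tuple.sort f).surjective.injective_comp_right.eq_iff]

/-- After exchanging sums, replacing `T` by its preimages under `u` absorbs `u`, so each of the `n!`
permutations `u` contributes equally. -/
theorem sum_fixedSets_pow (r : ℕ) :
    ∑ w : Perm (Fin n), fixedSets n k w ^ r = Fintype.card (Perm (Fin n)) *
      ∑ T : Fin r → Interleaving n k, if Tuple.sort (key T) = 1 then 1 else 0 := by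
  simp only [fixedSets_pow]
  have h (T : Fin r → Interleaving n k) :
      (∑ w : Perm (Fin n), if key T ∘ w = key T then 1 else 0 : ℕ) =
        ∑ u : Perm (Fin n), if Tuple.sort (key T ∘ u) = 1 then 1 else 0 := by
    convert sum_comp_eq_self_eq_sum_monotone (key T)
  rw [Finset.sum_comm]
  simp only [h]
  rw [Finset.sum_comm, ← smul_eq_mul, ← Finset.card_univ, ← Finset.sum_const]
  refine Finset.sum_congr rfl fun u _ => ?_
  rw [← (Equiv.piCongrRight fun _ : Fin r => Interleaving.preimage (n := n) (k := k) u).sum_comp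
    fun T => if Tuple.sort (key T) = 1 then 1 else 0]
  refine Finset.sum_congr rfl fun T _ => ?_
  rw [← key_preimage]
  rfl

theorem sum_fixedSets_pow_eq_trace (hk : k ≤ n) (r : ℕ) :
    ∑ w : Perm (Fin n), (fixedSets n k w : ℝ) ^ r =
      (n.choose k : ℝ) ^ r * (transition hk ^ r).trace := by
  rw [trace_transition_pow, mul_left_comm, transition_pow_apply_one]
  exact_mod_cast sum_fixedSets_pow r

theorem roots_charpoly_transition (hk : k ≤ n) :
    ((transition hk).map Complex.ofReal).charpoly.roots =
      (Finset.univ : Finset (Perm (Fin n))).val.map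
        fun w => (fixedSets n k w : ℂ) / (n.choose k : ℂ) := by
  refine Multiset.eq_of_sum_map_pow_eq fun r => ?_
  have hC : (n.choose k : ℂ) ≠ 0 := by exact_mod_cast (Nat.choose_pos hk).ne'
  have hpow : (transition hk).map Complex.ofReal ^ r =
      (transition hk ^ r).map Complex.ofReal :=
    (map_pow Complex.ofRealHom.mapMatrix (transition hk) r).symm
  have htr : ((transition hk ^ r).map Complex.ofReal).trace =
      ((transition hk ^ r).trace : ℂ) := by
    simp [Matrix.trace]
  have h := congrArg Complex.ofReal (sum_fixedSets_pow_eq_trace hk r)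
  push_cast at h
  rw [← Matrix.trace_pow_eq_sum_roots_charpoly, hpow, htr, Multiset.map_map]
  change _ = ∑ w : Perm (Fin n), ((fixedSets n k w : ℂ) / (n.choose k : ℂ)) ^ r
  simp only [div_pow]
  rw [← Finset.sum_div, h, mul_div_cancel_left₀ _ (pow_ne_zero r hC)]

end TopToRandom

theorem proposition4p4 (n k : ℕ) (hk : k ≤ n) :
    -- the complex eigenvalues, with algebraic multiplicity and as a set
    (((TopToRandom.transition hk).map Complex.ofReal).charpoly.roots =
        (Finset.univ : Finset (Equiv.Perm (Fin n))).val.map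
          fun w => (TopToRandom.fixedSets n k w : ℂ) / (n.choose k : ℂ)) ∧
    (∀ z : ℂ,
      Module.End.HasEigenvalue
          (Matrix.toLin' ((TopToRandom.transition hk).map Complex.ofReal)) z ↔
        ∃ w : Equiv.Perm (Fin n),
          z = (TopToRandom.fixedSets n k w : ℂ) / (n.choose k : ℂ)) ∧
    -- the moments
    (∀ r : ℕ,
      TopToRandom.fixedSetsMoment n k r =
        (n.choose k : ℝ) ^ r * (TopToRandom.law hk r 1).toReal) := by
  refine ⟨TopToRandom.roots_charpoly_transition hk, fun z => ?_, fun r => ?_⟩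
  · rw [Module.End.hasEigenvalue_iff_isRoot_charpoly, Matrix.charpoly_toLin',
      ← Polynomial.mem_roots (Matrix.charpoly_monic _).ne_zero,
      TopToRandom.roots_charpoly_transition hk]
    simp [eq_comm]
  · have hN : (Fintype.card (Equiv.Perm (Fin n)) : ℝ) ≠ 0 := by
      exact_mod_cast Fintype.card_ne_zero
    rw [TopToRandom.fixedSetsMoment, TopToRandom.sum_fixedSets_pow_eq_trace hk,
      TopToRandom.trace_transition_pow, TopToRandom.law_apply_toReal, mul_left_comm,
      mul_div_cancel_left₀ _ hN]
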